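/- For $\gamma>0$ and $a>0$ consider the iterative differential equation $-\gamma g'=g^{-1}$ on $[0,a]$: here $g\colon[0,a]\to[0,a]$ is a differentiable bijection (with one-sided derivatives at the endpoints), $g^{-1}$ is its compositional inverse, and the equation holds at every point of $[0,a]$. A *unit stribola* is a function $g\colon[0,1]\to[0,1]$ satisfying $-\gamma g'=g^{-1}$ on $[0,1]$ for some $\gamma>0$. A *standard stribola* is a function $g\colon[0,a]\to[0,a]$, for some $a>0$, satisfying $-g'=g^{-1}$ on $[0,a]$. For a decreasing $f\colon[0,1]\to[0,1]$ with $f(0)=1$ and $\int_0^1 f>0$ let $f^*(y)=\sup\{x\in[0,1]: f(x)\ge y\}$ for $y\in[0,1]$, and $(Tf)(x)=\int_x^1 f^*\big/\int_0^1 f^*$ for $x\in[0,1]$. Put $h_n=T^n 1_{[0,1]}$ for $n\ge 0$ (where $1_{[0,1]}$ is the constant function $1$ on $[0,1]$), $h=\lim_{n\to\infty}h_n$ and $\kappa=\int_0^1 h$. Then the sequence $(h_n)$ converges uniformly on $[0,1]$, so that $h$ is well defined, and $\kappa>0$. Moreover: 1. For $\gamma>0$, the equation $-\gamma g'=g^{-1}$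 has a solution $g\colon[0,1]\to[0,1]$ if and only if $\gamma=\kappa$. 2. The function $h$ is a unit stribola, and it is the only one. 3. The function $\tilde h\colon[0,\frac1\kappa]\to[0,\frac1\kappa]$, $\tilde h(x)=\frac1\kappa h(\kappa x)$, is a standard stribola, and it is the only one: if $a>0$ and $g\colon[0,a]\to[0,a]$ satisfies $-g'=g^{-1}$ on $[0,a]$, then $a=\frac1\kappa$ and $g=\tilde h$. -/

import Mathlib

open Set Filter Topology

namespace Stribola

noncomputable section

/-- The function `g`, restricted to `[0,a]`, is a differentiable bijection of `[0,a]` onto itself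
(so that its compositional inverse is a function `[0,a] → [0,a]`) and satisfies
`-γ g' = g⁻¹` on `[0,a]`; the derivatives at the endpoints are one-sided. -/
def SolvesIDE (γ a : ℝ) (g : ℝ → ℝ) : Prop :=
  BijOn g (Icc 0 a) (Icc 0 a) ∧ DifferentiableOn ℝ g (Icc 0 a) ∧
    ∀ x ∈ Icc 0 a, -γ * derivWithin g (Icc 0 a) x = Function.invFunOn g (Icc 0 a) x

/-- `g : [0,1] → [0,1]` satisfies `-γ g' = g⁻¹` for some `γ > 0`. -/
def IsUnitStribola (g : ℝ → ℝ) : Prop :=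
  ∃ γ : ℝ, 0 < γ ∧ SolvesIDE γ 1 g

/-- `a > 0` and `g : [0,a] → [0,a]` satisfies `-g' = g⁻¹`. -/
def IsStandardStribola (a : ℝ) (g : ℝ → ℝ) : Prop :=
  0 < a ∧ SolvesIDE 1 a g

/-- The pseudo-inverse `f*(y) = sup {x ∈ [0,1] | f x ≥ y}`, for `y ∈ [0,1]`. -/
def pseudoInv (f : ℝ → ℝ) (y : ℝ) : ℝ :=
  sSup {x : ℝ | x ∈ Icc (0 : ℝ) 1 ∧ y ≤ f x}

/-- `(I g)(x) = (∫ₓ¹ g) / (∫₀¹ g)`, for `x ∈ [0,1]`. -/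
def opI (g : ℝ → ℝ) (x : ℝ) : ℝ :=
  (∫ t in x..1, g t) / (∫ t in (0 : ℝ)..1, g t)

/-- The operator `T f = I f*`. -/
def opT (f : ℝ → ℝ) : ℝ → ℝ :=
  opI (pseudoInv f)

/-- The canonical stribolic iterates `hₙ = Tⁿ 1`. -/
def iter (n : ℕ) : ℝ → ℝ :=
  opT^[n] (fun _ => 1)

/-- The limit `h` of the canonical stribolic iterates (relevant on `[0,1]` only). -/
def h (x : ℝ) : ℝ :=
  limUnder atTop (fun n => iter n x)

/-- The area `κ = ∫₀¹ h`. -/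
def κ : ℝ :=
  ∫ x in (0 : ℝ)..1, h x

/-- The rescaled function `x ↦ (1/κ) h(κ x)`, a function on `[0,1/κ]`. -/
def hTilde (x : ℝ) : ℝ :=
  1 / κ * h (κ * x)

end

end Stribola

namespace Stribola

/-! Integrating `-γ g' = g⁻¹` from `x` to `1` shows that solutions on `[0,1]` are the decreasing
fixed points of `T`, with `γ` the area under the inverse. So the theorem amounts to `T` having
exactly one fixed point, the limit of `Tⁿ 1`.

The engine is the sign pattern of `f(αx) - β g(x)`, for all `α, β > 0` at once. For `Tf`, `Tg` the
same difference has derivative proportional to `δ g*(x) - f*(αx)`, where `δ = β area f / (α area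
g)`. Passing from pseudo-inverses back to functions turns this into a comparison of `f(δs)` with `α
g(s)`, with the order of the points reversed. Since `Tf` and `Tg` vanish far out, a pattern `+,-,+`
for `Tf, Tg` forces one for `f, g`; hence `T` preserves `AvoidsPosNegPos`. When `β = 1`, equality at
`0` strengthens this to `AvoidsNegPos`, and one more application of `T`, with `α = 1`, gives `Tg ≤
Tf`. The unit step avoids both patterns against every profile, so `Tⁿ g ≤ hₙ` for every profile `g`
(`iterate_opT_le_stepIter`).

With `g = T 1` the iterates decrease; the bound `(1-x)²/2` keeps the area of the limit positive, so
`h` is fixed by `T`. With `g` a fixed point, `g ≤ h`. If `g(x) < h(x)`, then `β g(x) < h(x)` for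
some `β > 1`, and the crossing argument propagates `β g ≤ h` to the right of `x`. This fails near
`1`, where every fixed point is asymptotic to `(1-y)²/2`. -/

lemma bddAbove_superlevel (f : ℝ → ℝ) (y : ℝ) :
    BddAbove {x : ℝ | x ∈ Icc (0 : ℝ) 1 ∧ y ≤ f x} :=
  ⟨1, fun _ hx => hx.1.2⟩

lemma pseudoInv_nonneg (f : ℝ → ℝ) (y : ℝ) : 0 ≤ pseudoInv f y :=
  Real.sSup_nonneg fun _ hx => hx.1.1

lemma pseudoInv_le_one (f : ℝ → ℝ) (y : ℝ) : pseudoInv f y ≤ 1 :=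
  Real.sSup_le (fun _ hx => hx.1.2) zero_le_one

lemma le_pseudoInv {f : ℝ → ℝ} {x y : ℝ} (hx : x ∈ Icc (0 : ℝ) 1) (hy : y ≤ f x) :
    x ≤ pseudoInv f y :=
  le_csSup (bddAbove_superlevel f y) ⟨hx, hy⟩

lemma pseudoInv_mono {f g : ℝ → ℝ} (hfg : ∀ x ∈ Icc (0 : ℝ) 1, f x ≤ g x) (y : ℝ) :
    pseudoInv f y ≤ pseudoInv g y :=
  Real.sSup_le (fun x hx => le_pseudoInv hx.1 (hx.2.trans (hfg x hx.1))) (pseudoInv_nonneg g y)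

lemma pseudoInv_antitone (f : ℝ → ℝ) : Antitone (pseudoInv f) := fun _ _ hab =>
  Real.sSup_le (fun _ hx => le_pseudoInv hx.1 (hab.trans hx.2)) (pseudoInv_nonneg f _)

lemma pseudoInv_congr {f g : ℝ → ℝ} (hfg : EqOn f g (Icc 0 1)) : pseudoInv f = pseudoInv g :=
  funext fun y => le_antisymm (pseudoInv_mono (fun _ hx => (hfg hx).le) y)
    (pseudoInv_mono (fun _ hx => (hfg hx).ge) y)

lemma opT_congr {f g : ℝ → ℝ} (hfg : EqOn f g (Icc 0 1)) : opT f = opT g := by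
  rw [opT, opT, pseudoInv_congr hfg]

lemma intervalIntegrable_pseudoInv (f : ℝ → ℝ) (a b : ℝ) :
    IntervalIntegrable (pseudoInv f) MeasureTheory.volume a b :=
  (pseudoInv_antitone f).intervalIntegrable

/-- The area under the pseudo-inverse. -/
noncomputable def area (f : ℝ → ℝ) : ℝ := ∫ t in (0 : ℝ)..1, pseudoInv f t

lemma area_le_one (f : ℝ → ℝ) : area f ≤ 1 := by
  have := intervalIntegral.integral_mono_on (zero_le_one' ℝ) (intervalIntegrable_pseudoInv f 0 1)
    (intervalIntegrable_const (c := (1 : ℝ))) fun x _ => pseudoInv_le_one f x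
  simpa [area] using this

lemma area_mono {f g : ℝ → ℝ} (hfg : ∀ x ∈ Icc (0 : ℝ) 1, f x ≤ g x) : area f ≤ area g :=
  intervalIntegral.integral_mono_on zero_le_one (intervalIntegrable_pseudoInv f 0 1)
    (intervalIntegrable_pseudoInv g 0 1) fun x _ => pseudoInv_mono hfg x

lemma opT_apply (f : ℝ → ℝ) (x : ℝ) :
    opT f x = (∫ t in x..1, pseudoInv f t) / area f := rfl

lemma opT_sub (f : ℝ → ℝ) (x y : ℝ) :
    opT f x - opT f y = (∫ t in x..y, pseudoInv f t) / area f := by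
  rw [opT_apply, opT_apply, ← sub_div, ← intervalIntegral.integral_add_adjacent_intervals
    (intervalIntegrable_pseudoInv f x y) (intervalIntegrable_pseudoInv f y 1), add_sub_cancel_right]

/-- Decreasing functions on `[0, ∞)` with `f 0 = 1`, supported in `[0, 1]`, of positive area. -/
structure IsProfile (f : ℝ → ℝ) : Prop where
  anti : AntitoneOn f (Ici 0)
  zero : f 0 = 1
  eq_zero : ∀ x, 1 < x → f x = 0
  area_pos : 0 < area f

/-! ### Action of `T` on profiles -/

namespace IsProfile

variable {f g : ℝ → ℝ}

lemma nonneg (hf : IsProfile f) {x : ℝ} (hx : 0 ≤ x) : 0 ≤ f x := by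
  rw [← hf.eq_zero (x + 2) (by linarith)]
  exact hf.anti hx (by simp only [mem_Ici]; linarith) (by linarith)

lemma le_one (hf : IsProfile f) {x : ℝ} (hx : 0 ≤ x) : f x ≤ 1 := by
  rw [← hf.zero]
  exact hf.anti self_mem_Ici hx hx

lemma le_of_lt_pseudoInv (hf : IsProfile f) {t y : ℝ} (ht : 0 ≤ t) (hty : t < pseudoInv f y) :
    y ≤ f t := by
  by_contra! hlt
  refine hty.not_ge (Real.sSup_le (fun x hx => ?_) ht)
  by_contra! htx
  exact hlt.not_ge (hx.2.trans (hf.anti ht hx.1.1 htx.le))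

lemma lt_of_pseudoInv_lt (hf : IsProfile f) {t y : ℝ} (hy : 0 < y) (ht : 0 ≤ t)
    (hty : pseudoInv f y < t) : f t < y := by
  by_contra! hle
  rcases le_or_gt t 1 with h1 | h1
  · exact hty.not_ge (le_pseudoInv ⟨ht, h1⟩ hle)
  · rw [hf.eq_zero t h1] at hle
    exact hy.not_ge hle

lemma pseudoInv_eq_zero (hf : IsProfile f) {y : ℝ} (hy : 1 < y) : pseudoInv f y = 0 := by
  refine le_antisymm (Real.sSup_le (fun x hx => ?_) le_rfl) (pseudoInv_nonneg f y)
  -- Above height `1` the superlevel set is empty, and the supremum takes its default value `0`.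
  exact absurd (hx.2.trans (hf.le_one hx.1.1)) hy.not_ge

lemma opT_antitone (hf : IsProfile f) : Antitone (opT f) := fun x y hxy => by
  rw [← sub_nonneg, opT_sub]
  exact div_nonneg (intervalIntegral.integral_nonneg hxy fun t _ => pseudoInv_nonneg f t)
    hf.area_pos.le

lemma opT_zero (hf : IsProfile f) : opT f 0 = 1 := div_self hf.area_pos.ne'

lemma opT_eq_zero (hf : IsProfile f) {x : ℝ} (hx : 1 ≤ x) : opT f x = 0 := by
  rw [opT_apply, intervalIntegral.integral_symm, intervalIntegral.integral_zero_ae, neg_zero,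
    zero_div]
  refine Eventually.of_forall fun t ht => hf.pseudoInv_eq_zero ?_
  rw [uIoc_of_le hx] at ht
  exact ht.1

lemma opT_sub_le (hf : IsProfile f) {x y : ℝ} (hxy : x ≤ y) :
    opT f x - opT f y ≤ (y - x) / area f := by
  rw [opT_sub]
  have := intervalIntegral.integral_mono_on hxy (intervalIntegrable_pseudoInv f x y)
    (intervalIntegrable_const (c := (1 : ℝ))) fun x _ => pseudoInv_le_one f x
  exact div_le_div_of_nonneg_right (by simpa using this) hf.area_pos.le

lemma continuous_opT (hf : IsProfile f) : Continuous (opT f) := by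
  refine (LipschitzWith.of_dist_le_mul (K := (area f)⁻¹.toNNReal) fun x y => ?_).continuous
  rw [Real.coe_toNNReal _ (inv_nonneg.2 hf.area_pos.le), Real.dist_eq, Real.dist_eq]
  wlog hxy : x ≤ y generalizing x y
  · rw [abs_sub_comm, abs_sub_comm x]
    exact this y x (le_of_not_ge hxy)
  rw [abs_of_nonneg (sub_nonneg.2 (hf.opT_antitone hxy)), abs_sub_comm,
    abs_of_nonneg (sub_nonneg.2 hxy), inv_mul_eq_div]
  exact hf.opT_sub_le hxy

/-- `opT f` starts at `1` and falls with slope at most `1 / area f`, so it is still at least `y` at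
the point `area f * (1 - y)`. -/
lemma le_pseudoInv_opT (hf : IsProfile f) {y : ℝ} (hy : y ∈ Icc (0 : ℝ) 1) :
    area f * (1 - y) ≤ pseudoInv (opT f) y := by
  have ha := hf.area_pos
  have h1 := area_le_one f
  have h0 : 0 ≤ area f * (1 - y) := mul_nonneg ha.le (by linarith [hy.2])
  refine le_pseudoInv ⟨h0, by nlinarith [hy.1, hy.2]⟩ ?_
  have := hf.opT_sub_le h0
  rw [hf.opT_zero, sub_zero, mul_div_cancel_left₀ _ ha.ne'] at this
  linarith

lemma isProfile_opT (hf : IsProfile f) : IsProfile (opT f) where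
  anti := hf.opT_antitone.antitoneOn _
  zero := hf.opT_zero
  eq_zero _ hx := hf.opT_eq_zero hx.le
  area_pos := by
    have := intervalIntegral.integral_mono_on (zero_le_one' ℝ)
      (Continuous.intervalIntegrable (u := fun y => area f * (1 - y)) (by fun_prop) 0 1)
      (intervalIntegrable_pseudoInv (opT f) 0 1)
      fun y hy => hf.le_pseudoInv_opT hy
    refine lt_of_lt_of_le ?_ this
    rw [intervalIntegral.integral_const_mul, intervalIntegral.integral_sub (by simp) (by simp)]
    simp
    have := hf.area_pos
    linarith

end IsProfile

/-! ### Sign patterns of `f (α x) - β g x` under `T` -/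

section Crossing

variable {f g : ℝ → ℝ} {α β x y : ℝ}

lemma opT_mul_sub (hα : 0 < α) :
    opT f (α * x) - opT f (α * y) = α / area f * ∫ t in x..y, pseudoInv f (α * t) := by
  rw [opT_sub, intervalIntegral.integral_comp_mul_left _ hα.ne', smul_eq_mul]
  field_simp

lemma intervalIntegrable_pseudoInv_mul (hα : 0 < α) (a b : ℝ) :
    IntervalIntegrable (fun t => pseudoInv f (α * t)) MeasureTheory.volume a b :=
  Antitone.intervalIntegrable fun _ _ h => pseudoInv_antitone f (by gcongr)

lemma diff_eq (hf : IsProfile f) (hg : IsProfile g) (hα : 0 < α) :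
    (opT f (α * x) - β * opT g x) - (opT f (α * y) - β * opT g y) = α / area f *
      ∫ t in x..y, (pseudoInv f (α * t) - β * area f / (α * area g) * pseudoInv g t) := by
  rw [intervalIntegral.integral_sub (intervalIntegrable_pseudoInv_mul hα _ _)
    ((intervalIntegrable_pseudoInv g _ _).const_mul _), mul_sub, ← opT_mul_sub hα,
    intervalIntegral.integral_const_mul]
  have h1 := opT_sub g x y
  have := hf.area_pos
  have := hg.area_pos
  have h2 : α / area f * (β * area f / (α * area g) * ∫ t in x..y, pseudoInv g t)
    = β * ((∫ t in x..y, pseudoInv g t) / area g) := by field_simp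
  rw [h2, ← h1]
  ring

/-- A fall of the difference makes the integrand in `diff_eq` positive at some `t`. A point `s`
strictly between the two pseudo-inverse values then satisfies `g s < t` and `α t ≤ f (δ s)`. The
bounds on `s` by pseudo-inverses are kept in order to compare points arising from different `t`. -/
lemma exists_above (hf : IsProfile f) (hg : IsProfile g) (hα : 0 < α) (hβ : 0 < β)
    (hx : 0 ≤ x) (hxy : x < y)
    (hU : opT f (α * y) - β * opT g y < opT f (α * x) - β * opT g x) :
    ∃ t ∈ Ioo x y, ∃ s, 0 ≤ s ∧ pseudoInv g t < s ∧
      β * area f / (α * area g) * s < pseudoInv f (α * t) ∧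
      α * g s < f (β * area f / (α * area g) * s) := by
  have hδ : 0 < β * area f / (α * area g) := by
    have := hf.area_pos
    have := hg.area_pos
    positivity
  have key := diff_eq (x := x) (y := y) (β := β) hf hg hα
  set δ := β * area f / (α * area g)
  obtain ⟨t, ht, hlt⟩ : ∃ t ∈ Ioo x y, δ * pseudoInv g t < pseudoInv f (α * t) := by
    by_contra! hle
    have := intervalIntegral.integral_mono_on_of_le_Ioo hxy.le
      ((intervalIntegrable_pseudoInv_mul (f := f) hα x y).sub
        ((intervalIntegrable_pseudoInv g x y).const_mul δ))
      (intervalIntegrable_const (c := (0 : ℝ))) fun t ht => sub_nonpos.2 (hle t ht)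
    rw [intervalIntegral.integral_zero] at this
    have := mul_nonpos_of_nonneg_of_nonpos (div_nonneg hα.le hf.area_pos.le) this
    linarith
  refine ⟨t, ht, ?_⟩
  have ht0 : 0 < t := hx.trans_lt ht.1
  obtain ⟨s, hs1, hs2⟩ := exists_between ((lt_div_iff₀' hδ).2 hlt)
  have hs0 : 0 ≤ s := (pseudoInv_nonneg g t).trans hs1.le
  rw [lt_div_iff₀' hδ] at hs2
  refine ⟨s, hs0, hs1, hs2, ?_⟩
  calc α * g s < α * t := by
        have := hg.lt_of_pseudoInv_lt ht0 hs0 hs1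
        gcongr
    _ ≤ f (δ * s) := hf.le_of_lt_pseudoInv (by positivity) hs2

lemma exists_below (hf : IsProfile f) (hg : IsProfile g) (hα : 0 < α) (hβ : 0 < β)
    (hx : 0 ≤ x) (hxy : x < y)
    (hU : opT f (α * x) - β * opT g x < opT f (α * y) - β * opT g y) :
    ∃ t ∈ Ioo x y, ∃ s, 0 ≤ s ∧ s < pseudoInv g t ∧
      pseudoInv f (α * t) < β * area f / (α * area g) * s ∧
      f (β * area f / (α * area g) * s) < α * g s := by
  have hδ : 0 < β * area f / (α * area g) := by
    have := hf.area_pos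
    have := hg.area_pos
    positivity
  have key := diff_eq (x := x) (y := y) (β := β) hf hg hα
  set δ := β * area f / (α * area g)
  obtain ⟨t, ht, hlt⟩ : ∃ t ∈ Ioo x y, pseudoInv f (α * t) < δ * pseudoInv g t := by
    by_contra! hle
    have := intervalIntegral.integral_mono_on_of_le_Ioo hxy.le
      (intervalIntegrable_const (c := (0 : ℝ)))
      ((intervalIntegrable_pseudoInv_mul (f := f) hα x y).sub
        ((intervalIntegrable_pseudoInv g x y).const_mul δ)) fun t ht => sub_nonneg.2 (hle t ht)
    rw [intervalIntegral.integral_zero] at this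
    have := mul_nonneg (div_nonneg hα.le hf.area_pos.le) this
    linarith
  refine ⟨t, ht, ?_⟩
  have ht0 : 0 < t := hx.trans_lt ht.1
  obtain ⟨s, hs1, hs2⟩ := exists_between ((div_lt_iff₀' hδ).2 hlt)
  have hs0 : 0 ≤ s := (div_nonneg (pseudoInv_nonneg f _) hδ.le).trans hs1.le
  rw [div_lt_iff₀' hδ] at hs1
  refine ⟨s, hs0, hs2, hs1, ?_⟩
  calc f (δ * s) < α * t := hf.lt_of_pseudoInv_lt (by positivity) (by positivity) hs1
    _ ≤ α * g s := by
        have := hg.le_of_lt_pseudoInv hs0 hs2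
        gcongr

/-- For all `α, β > 0`, the function `x ↦ f (α x) - β g x` on `[0, ∞)` never takes the
signs `+, -, +` in this order. -/
def AvoidsPosNegPos (f g : ℝ → ℝ) : Prop :=
  ∀ α β x y z : ℝ, 0 < α → 0 < β → 0 ≤ x → x < y → y < z →
    β * g x < f (α * x) → f (α * y) < β * g y → ¬ β * g z < f (α * z)

/-- For all `α > 0`, the function `x ↦ f (α x) - g x` on `[0, ∞)` never takes the
signs `-, +` in this order. -/
def AvoidsNegPos (f g : ℝ → ℝ) : Prop :=
  ∀ α x y : ℝ, 0 < α → 0 ≤ x → x < y → f (α * x) < g x → ¬ g y < f (α * y)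

lemma exists_vanishing (hf : IsProfile f) (hg : IsProfile g) (hα : 0 < α) (y : ℝ) :
    ∃ w, y < w ∧ opT f (α * w) = 0 ∧ opT g w = 0 := by
  refine ⟨max (y + 1) (max 1 α⁻¹), (lt_add_one y).trans_le (le_max_left _ _),
    hf.opT_eq_zero ?_, hg.opT_eq_zero ((le_max_left _ _).trans (le_max_right _ _))⟩
  rw [← inv_le_iff_one_le_mul₀' hα]
  exact (le_max_right _ _).trans (le_max_right _ _)

lemma AvoidsPosNegPos.avoidsPosNegPos_opT (hfg : AvoidsPosNegPos f g) (hf : IsProfile f) (hg : IsProfile g) :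
    AvoidsPosNegPos (opT f) (opT g) := by
  intro α β x y z hα hβ hx hxy hyz h1 h2 h3
  -- The common zero `w` adds a third move: the difference falls, rises, then falls again.
  obtain ⟨w, hzw, hw1, hw2⟩ := exists_vanishing hf hg hα z
  obtain ⟨t₁, ht₁, s₁, hs₁, ha₁, hb₁, hc₁⟩ :=
    exists_above hf hg hα hβ hx hxy (by linarith)
  obtain ⟨t₂, ht₂, s₂, hs₂, ha₂, hb₂, hc₂⟩ :=
    exists_below hf hg hα hβ (hx.trans hxy.le) hyz (by linarith)
  obtain ⟨t₃, ht₃, s₃, hs₃, ha₃, hb₃, hc₃⟩ :=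
    exists_above hf hg hα hβ (hx.trans (hxy.trans hyz).le) hzw (by rw [hw1, hw2]; linarith)
  have hδ : 0 < β * area f / (α * area g) := by
    have := hf.area_pos
    have := hg.area_pos
    positivity
  -- Pseudo-inverses are decreasing, so `t₁ < t₂ < t₃` yields `s₃ < s₂ < s₁`.
  refine hfg _ α s₃ s₂ s₁ hδ hα hs₃ ?_ ?_ hc₃ hc₂ hc₁
  · refine lt_of_mul_lt_mul_left (hb₃.trans_le ((pseudoInv_antitone f ?_).trans hb₂.le)) hδ.le
    exact mul_le_mul_of_nonneg_left (ht₂.2.trans ht₃.1).le hα.le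
  · exact ha₂.trans_le ((pseudoInv_antitone g (ht₁.2.trans ht₂.1).le).trans ha₁.le)

/-- Both functions equal `1` at `0`, so with `β = 1` the values `0, -, +, 0` already give the three
moves that `+, -, +, 0` gave before. -/
lemma AvoidsPosNegPos.avoidsNegPos_opT (hfg : AvoidsPosNegPos f g) (hf : IsProfile f)
    (hg : IsProfile g) : AvoidsNegPos (opT f) (opT g) := by
  intro α x y hα hx hxy h1 h2
  have h0 : 0 < x := by
    refine lt_of_le_of_ne hx fun h => ?_
    rw [← h, mul_zero, hf.opT_zero, hg.opT_zero] at h1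
    exact h1.false
  obtain ⟨w, hyw, hw1, hw2⟩ := exists_vanishing hf hg hα y
  obtain ⟨t₁, ht₁, s₁, hs₁, ha₁, hb₁, hc₁⟩ :=
    exists_above hf hg hα one_pos le_rfl h0 (by rw [mul_zero, hf.opT_zero, hg.opT_zero]; linarith)
  obtain ⟨t₂, ht₂, s₂, hs₂, ha₂, hb₂, hc₂⟩ :=
    exists_below hf hg hα one_pos hx hxy (by linarith)
  obtain ⟨t₃, ht₃, s₃, hs₃, ha₃, hb₃, hc₃⟩ :=
    exists_above hf hg hα one_pos (hx.trans hxy.le) hyw (by rw [hw1, hw2]; linarith)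
  have hδ : 0 < 1 * area f / (α * area g) := by
    have := hf.area_pos
    have := hg.area_pos
    positivity
  refine hfg _ α s₃ s₂ s₁ hδ hα hs₃ ?_ ?_ hc₃ hc₂ hc₁
  · refine lt_of_mul_lt_mul_left (hb₃.trans_le ((pseudoInv_antitone f ?_).trans hb₂.le)) hδ.le
    exact mul_le_mul_of_nonneg_left (ht₂.2.trans ht₃.1).le hα.le
  · exact ha₂.trans_le ((pseudoInv_antitone g (ht₁.2.trans ht₂.1).le).trans ha₁.le)

/-- With `α = 1`, a fall to a negative value followed by the return to `0` gives two moves, hence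
the forbidden pattern `-, +` for `f` and `g`. -/
lemma AvoidsNegPos.false_of_opT (hfg : AvoidsNegPos f g) (hf : IsProfile f)
    (hg : IsProfile g) (hβ : 0 < β) (hx : 0 ≤ x) (hxy : x < y)
    (h1 : opT f y - β * opT g y < opT f x - β * opT g x) (h2 : opT f y < β * opT g y) : False := by
  obtain ⟨w, hyw, hw1, hw2⟩ := exists_vanishing hf hg one_pos y
  obtain ⟨t₁, ht₁, s₁, hs₁, ha₁, hb₁, hc₁⟩ :=
    exists_above hf hg one_pos hβ hx hxy (by simpa using h1)
  obtain ⟨t₂, ht₂, s₂, hs₂, ha₂, hb₂, hc₂⟩ :=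
    exists_below hf hg one_pos hβ (hx.trans hxy.le) hyw (by rw [hw1, hw2, one_mul]; linarith)
  rw [one_mul (g _)] at hc₁ hc₂
  refine hfg _ s₂ s₁ ?_ hs₂ ?_ hc₂ hc₁
  · have := hf.area_pos
    have := hg.area_pos
    positivity
  · exact ha₂.trans_le ((pseudoInv_antitone g (ht₁.2.trans ht₂.1).le).trans ha₁.le)

lemma AvoidsNegPos.opT_le (hfg : AvoidsNegPos f g) (hf : IsProfile f)
    (hg : IsProfile g) (hx : 0 ≤ x) : opT g x ≤ opT f x := by
  by_contra! hlt
  rcases hx.eq_or_lt with rfl | h0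
  · rw [hf.opT_zero, hg.opT_zero] at hlt
    exact hlt.false
  · refine hfg.false_of_opT hf hg one_pos le_rfl h0 ?_ (by simpa using hlt)
    rw [hf.opT_zero, hg.opT_zero]
    linarith

end Crossing

/-! ### Comparison with the iterates of the unit step -/

lemma isProfile_indicator {f : ℝ → ℝ} (hf : AntitoneOn f (Icc 0 1)) (h0 : f 0 = 1)
    (h1 : 0 ≤ f 1) (ha : 0 < area f) : IsProfile (indicator (Icc 0 1) f) where
  anti x hx y hy hxy := by
    rcases le_or_gt y 1 with hy1 | hy1
    · have hx' : x ∈ Icc (0 : ℝ) 1 := ⟨hx, hxy.trans hy1⟩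
      have hy' : y ∈ Icc (0 : ℝ) 1 := ⟨hy, hy1⟩
      rw [indicator_of_mem hx', indicator_of_mem hy']
      exact hf hx' hy' hxy
    · rw [indicator_of_notMem fun h => hy1.not_ge h.2]
      exact indicator_nonneg
        (fun z hz => h1.trans (hf hz (right_mem_Icc.2 zero_le_one) hz.2)) x
  zero := by rw [indicator_of_mem (left_mem_Icc.2 zero_le_one), h0]
  eq_zero x hx := indicator_of_notMem (fun h => hx.not_ge h.2) f
  area_pos := by
    rwa [area, pseudoInv_congr (eqOn_indicator (f := f) (s := Icc 0 1))]

/-- The indicator function of `[0, 1]`. -/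
noncomputable def unitStep : ℝ → ℝ := indicator (Icc 0 1) fun _ => 1

lemma unitStep_apply {x : ℝ} (hx : x ∈ Icc (0 : ℝ) 1) : unitStep x = 1 := indicator_of_mem hx _

lemma unitStep_of_one_lt {x : ℝ} (hx : 1 < x) : unitStep x = 0 :=
  indicator_of_notMem (fun h => hx.not_ge h.2) _

lemma isProfile_unitStep : IsProfile unitStep := by
  refine isProfile_indicator antitoneOn_const rfl zero_le_one ?_
  have := intervalIntegral.integral_mono_on (zero_le_one' ℝ)
    (intervalIntegrable_const (c := (1 : ℝ))) (intervalIntegrable_pseudoInv (fun _ => 1) 0 1)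
    fun y hy => le_pseudoInv (right_mem_Icc.2 zero_le_one) hy.2
  rw [intervalIntegral.integral_const, sub_zero, one_smul] at this
  exact one_pos.trans_le this

lemma avoidsNegPos_unitStep {g : ℝ → ℝ} (hg : IsProfile g) : AvoidsNegPos unitStep g := by
  intro α x y hα hx hxy h1 h2
  have hy : α * y ≤ 1 := by
    by_contra! hlt
    rw [unitStep_of_one_lt hlt] at h2
    exact h2.not_ge (hg.nonneg (hx.trans hxy.le))
  have hx1 : α * x ≤ 1 := (mul_le_mul_of_nonneg_left hxy.le hα.le).trans hy
  rw [unitStep_apply ⟨by positivity, hx1⟩] at h1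
  exact h1.not_ge (hg.le_one hx)

lemma avoidsPosNegPos_unitStep {g : ℝ → ℝ} (hg : IsProfile g) : AvoidsPosNegPos unitStep g := by
  intro α β x y z hα hβ hx hxy hyz h1 h2 h3
  have hy0 := hx.trans hxy.le
  have hz : α * z ≤ 1 := by
    by_contra! hlt
    rw [unitStep_of_one_lt hlt] at h3
    exact h3.not_ge (mul_nonneg hβ.le (hg.nonneg (hy0.trans hyz.le)))
  have hy1 : α * y ≤ 1 := (mul_le_mul_of_nonneg_left hyz.le hα.le).trans hz
  have hx1 : α * x ≤ 1 := (mul_le_mul_of_nonneg_left hxy.le hα.le).trans hy1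
  rw [unitStep_apply ⟨by positivity, hx1⟩] at h1
  rw [unitStep_apply ⟨by positivity, hy1⟩] at h2
  have := mul_le_mul_of_nonneg_left (hg.anti hx hy0 hxy.le) hβ.le
  linarith

lemma IsProfile.iterate_opT {f : ℝ → ℝ} (hf : IsProfile f) (n : ℕ) : IsProfile (opT^[n] f) := by
  induction n with
  | zero => exact hf
  | succ n ih =>
    rw [Function.iterate_succ_apply']
    exact ih.isProfile_opT

/-- The iterates of `opT` at the indicator function of `[0, 1]`. -/
noncomputable def stepIter (n : ℕ) : ℝ → ℝ := opT^[n] unitStep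

lemma stepIter_succ (n : ℕ) : stepIter (n + 1) = opT (stepIter n) :=
  Function.iterate_succ_apply' _ _ _

lemma isProfile_stepIter (n : ℕ) : IsProfile (stepIter n) := isProfile_unitStep.iterate_opT n

/-- The constant `1` is not a profile, as it does not vanish past `1`. `opT` sees only `[0,1]`, so
one application removes the difference. -/
lemma iter_succ (n : ℕ) : iter (n + 1) = stepIter (n + 1) := by
  induction n with
  | zero => exact opT_congr fun x hx => (unitStep_apply hx).symm
  | succ n ih => rw [iter, Function.iterate_succ_apply', ← iter, ih, stepIter_succ (n + 1)]

lemma eqOn_iter (n : ℕ) : EqOn (iter n) (stepIter n) (Icc 0 1) := by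
  cases n with
  | zero => exact fun x hx => (unitStep_apply hx).symm
  | succ n => rw [iter_succ]; exact eqOn_refl _ _

lemma avoidsNegPos_stepIter {g : ℝ → ℝ} (hg : IsProfile g) (n : ℕ) :
    AvoidsNegPos (stepIter n) (opT^[n] g) := by
  have hP : ∀ n, AvoidsPosNegPos (stepIter n) (opT^[n] g) := by
    intro n
    induction n with
    | zero => exact avoidsPosNegPos_unitStep hg
    | succ n ih =>
      rw [stepIter_succ, Function.iterate_succ_apply']
      exact ih.avoidsPosNegPos_opT (isProfile_stepIter n) (hg.iterate_opT n)
  cases n with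
  | zero => exact avoidsNegPos_unitStep hg
  | succ n =>
    rw [stepIter_succ, Function.iterate_succ_apply']
    exact (hP n).avoidsNegPos_opT (isProfile_stepIter n) (hg.iterate_opT n)

lemma iterate_opT_le_stepIter {g : ℝ → ℝ} (hg : IsProfile g) (n : ℕ) {x : ℝ}
    (hx : x ∈ Icc (0 : ℝ) 1) : opT^[n] g x ≤ stepIter n x := by
  cases n with
  | zero =>
    rw [stepIter, Function.iterate_zero_apply, Function.iterate_zero_apply, unitStep_apply hx]
    exact hg.le_one hx.1
  | succ n =>
    rw [stepIter_succ, Function.iterate_succ_apply']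
    exact (avoidsNegPos_stepIter hg n).opT_le (isProfile_stepIter n) (hg.iterate_opT n) hx.1

lemma antitone_stepIter {x : ℝ} (hx : x ∈ Icc (0 : ℝ) 1) : Antitone fun n => stepIter n x :=
  antitone_nat_of_succ_le fun n => by
    have := iterate_opT_le_stepIter isProfile_unitStep.isProfile_opT n hx
    rwa [← Function.iterate_succ_apply] at this

/-- Integrating `le_pseudoInv_opT` gives `area f * (1 - x)² / 2`, and `ha` absorbs the normalising
factor `area (opT f)`. -/
lemma IsProfile.sq_le_opT_opT {f : ℝ → ℝ} (hf : IsProfile f) (ha : area (opT f) ≤ area f) {x : ℝ}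
    (hx : x ∈ Icc (0 : ℝ) 1) : (1 - x) ^ 2 / 2 ≤ opT (opT f) x := by
  have hp := hf.isProfile_opT.area_pos
  rw [opT_apply (opT f), le_div_iff₀ hp]
  have := intervalIntegral.integral_mono_on hx.2
      (Continuous.intervalIntegrable (u := fun y => area f * (1 - y)) (by fun_prop) x 1)
      (intervalIntegrable_pseudoInv (opT f) x 1)
      fun y hy => hf.le_pseudoInv_opT ⟨hx.1.trans hy.1, hy.2⟩
  rw [intervalIntegral.integral_const_mul, intervalIntegral.integral_sub (by simp) (by simp),
    integral_id, intervalIntegral.integral_const, smul_eq_mul] at this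
  refine le_trans ?_ this
  have := mul_le_mul_of_nonneg_left ha (div_nonneg (sq_nonneg (1 - x)) zero_le_two)
  linarith

lemma sq_le_stepIter (n : ℕ) {x : ℝ} (hx : x ∈ Icc (0 : ℝ) 1) :
    (1 - x) ^ 2 / 2 ≤ stepIter n x := by
  refine le_trans ?_ (antitone_stepIter hx (Nat.le_add_right n 2))
  beta_reduce
  rw [stepIter_succ, stepIter_succ]
  refine (isProfile_stepIter n).sq_le_opT_opT ?_ hx
  rw [← stepIter_succ]
  exact area_mono fun y hy => antitone_stepIter hy n.le_succ

lemma area_pos_of_sq_le {f : ℝ → ℝ} (hf : ∀ x ∈ Icc (0 : ℝ) 1, (1 - x) ^ 2 / 2 ≤ f x) :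
    0 < area f := by
  -- `1/8` is the value of `(1 - x)² / 2` at `x = 1/2`, so the pseudo-inverse is at least `1/2` on
  -- `[0, 1/8]`.
  have h1 := intervalIntegral.integral_mono_on (by norm_num : (0 : ℝ) ≤ 1 / 8)
    (intervalIntegrable_const (c := (1 / 2 : ℝ))) (intervalIntegrable_pseudoInv f 0 (1 / 8))
    fun y hy => le_pseudoInv (x := 1 / 2) (by norm_num)
      (le_trans (le_trans hy.2 (by norm_num)) (hf (1 / 2) (by norm_num)))
  have h2 := intervalIntegral.integral_nonneg (μ := MeasureTheory.volume)
    (by norm_num : (1 / 8 : ℝ) ≤ 1) fun t _ => pseudoInv_nonneg f t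
  rw [area, ← intervalIntegral.integral_add_adjacent_intervals
    (intervalIntegrable_pseudoInv f 0 (1 / 8)) (intervalIntegrable_pseudoInv f _ 1)]
  rw [intervalIntegral.integral_const, smul_eq_mul] at h1
  linarith

/-! ### The limit `h` is a fixed point -/

lemma tendsto_stepIter {x : ℝ} (hx : x ∈ Icc (0 : ℝ) 1) :
    Tendsto (fun n => stepIter n x) atTop (𝓝 (h x)) := by
  have hex : Tendsto (fun n => stepIter n x) atTop (𝓝 (⨅ n, stepIter n x)) :=
    tendsto_atTop_ciInf (antitone_stepIter hx)
      ⟨0, forall_mem_range.2 fun n => (isProfile_stepIter n).nonneg hx.1⟩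
  have heq : (fun n => iter n x) = fun n => stepIter n x := funext fun n => eqOn_iter n hx
  rw [h, heq, hex.limUnder_eq]
  exact hex

lemma h_le_stepIter (n : ℕ) {x : ℝ} (hx : x ∈ Icc (0 : ℝ) 1) : h x ≤ stepIter n x :=
  (antitone_stepIter hx).le_of_tendsto (tendsto_stepIter hx) n

lemma sq_le_h {x : ℝ} (hx : x ∈ Icc (0 : ℝ) 1) : (1 - x) ^ 2 / 2 ≤ h x :=
  ge_of_tendsto' (tendsto_stepIter hx) fun n => sq_le_stepIter n hx

lemma area_h_pos : 0 < area h := area_pos_of_sq_le fun _ hx => sq_le_h hx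

lemma antitoneOn_h : AntitoneOn h (Icc 0 1) := fun _ hx _ hy hxy =>
  le_of_tendsto_of_tendsto' (tendsto_stepIter hy) (tendsto_stepIter hx) fun n =>
    (isProfile_stepIter n).anti hx.1 hy.1 hxy

lemma h_zero : h 0 = 1 :=
  tendsto_nhds_unique (tendsto_stepIter (left_mem_Icc.2 zero_le_one)) <|
    tendsto_const_nhds.congr fun n => (isProfile_stepIter n).zero.symm

lemma tendsto_pseudoInv_stepIter (y : ℝ) :
    Tendsto (fun n => pseudoInv (stepIter n) y) atTop (𝓝 (pseudoInv h y)) := by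
  have hlow : ∀ n, pseudoInv h y ≤ pseudoInv (stepIter n) y := fun n =>
    pseudoInv_mono (fun x hx => h_le_stepIter n hx) y
  have hbdd : BddBelow (range fun n => pseudoInv (stepIter n) y) := ⟨_, forall_mem_range.2 hlow⟩
  have hex := tendsto_atTop_ciInf (f := fun n => pseudoInv (stepIter n) y)
    (fun m n hmn => pseudoInv_mono (fun x hx => antitone_stepIter hx hmn) y) hbdd
  convert hex using 2
  -- A point `t ≥ 0` below every pseudo-inverse has `y ≤ stepIter n t` for all `n`, an inequality
  -- that survives the limit.
  refine le_antisymm (le_ciInf hlow) (le_of_forall_lt_imp_le_of_dense fun t ht => ?_)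
  rcases lt_or_ge t 0 with h0 | h0
  · exact h0.le.trans (pseudoInv_nonneg h y)
  have hlt : ∀ n, t < pseudoInv (stepIter n) y := fun n => ht.trans_le (ciInf_le hbdd n)
  have ht1 : t ∈ Icc (0 : ℝ) 1 := ⟨h0, (hlt 0).le.trans (pseudoInv_le_one _ _)⟩
  exact le_pseudoInv ht1 <| ge_of_tendsto' (tendsto_stepIter ht1) fun n =>
    (isProfile_stepIter n).le_of_lt_pseudoInv h0 (hlt n)

lemma tendsto_integral_pseudoInv_stepIter (a b : ℝ) :
    Tendsto (fun n => ∫ t in a..b, pseudoInv (stepIter n) t) atTop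
      (𝓝 (∫ t in a..b, pseudoInv h t)) := by
  refine intervalIntegral.tendsto_integral_filter_of_dominated_convergence (fun _ => 1)
    (.of_forall fun n => (pseudoInv_antitone _).measurable.aestronglyMeasurable)
    (.of_forall fun n => .of_forall fun t _ => ?_) intervalIntegrable_const
    (.of_forall fun t _ => tendsto_pseudoInv_stepIter t)
  rw [Real.norm_of_nonneg (pseudoInv_nonneg _ _)]
  exact pseudoInv_le_one _ _

lemma eqOn_h_opT : EqOn h (opT h) (Icc 0 1) := by
  intro x hx
  refine tendsto_nhds_unique ((tendsto_add_atTop_iff_nat 1).2 (tendsto_stepIter hx)) ?_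
  simp only [stepIter_succ]
  exact (tendsto_integral_pseudoInv_stepIter x 1).div (tendsto_integral_pseudoInv_stepIter 0 1)
    area_h_pos.ne'

/-- Profiles that are fixed by `opT`. -/
structure IsFixedProfile (f : ℝ → ℝ) : Prop extends IsProfile f where
  fixed : opT f = f

/-- Values of `f` outside `[0,1]` are arbitrary; `opT f` is the extension that is a profile. -/
lemma isFixedProfile_opT {f : ℝ → ℝ} (hf : AntitoneOn f (Icc 0 1)) (h0 : f 0 = 1)
    (h1 : 0 ≤ f 1) (ha : 0 < area f) (hfix : EqOn f (opT f) (Icc 0 1)) :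
    IsFixedProfile (opT f) where
  toIsProfile := by
    rw [← opT_congr (eqOn_indicator (f := f) (s := Icc 0 1))]
    exact (isProfile_indicator hf h0 h1 ha).isProfile_opT
  fixed := (opT_congr hfix).symm

lemma isFixedProfile_opT_h : IsFixedProfile (opT h) :=
  isFixedProfile_opT antitoneOn_h h_zero
    (le_trans (by norm_num) (sq_le_h (right_mem_Icc.2 zero_le_one))) area_h_pos eqOn_h_opT

/-! ### Uniqueness of the fixed point -/

namespace IsFixedProfile

variable {f g : ℝ → ℝ}

lemma sq_le (hf : IsFixedProfile f) {x : ℝ} (hx : x ∈ Icc (0 : ℝ) 1) :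
    (1 - x) ^ 2 / 2 ≤ f x := by
  have := hf.sq_le_opT_opT (by rw [hf.fixed]) hx
  rwa [hf.fixed, hf.fixed] at this

lemma sub_eq (hf : IsFixedProfile f) (x y : ℝ) :
    f x - f y = (∫ t in x..y, pseudoInv f t) / area f := by
  have := opT_sub f x y
  rwa [hf.fixed] at this

lemma eq_zero_one (hf : IsFixedProfile f) : f 1 = 0 := by
  rw [← hf.fixed]
  exact hf.opT_eq_zero le_rfl

lemma le_h (hg : IsFixedProfile g) {x : ℝ} (hx : x ∈ Icc (0 : ℝ) 1) : g x ≤ h x :=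
  ge_of_tendsto' (tendsto_stepIter hx) fun n => by
    have := iterate_opT_le_stepIter hg.toIsProfile n hx
    rwa [Function.iterate_fixed hg.fixed] at this

lemma mul_le_h (hg : IsFixedProfile g) {β x y : ℝ} (hβ : 0 < β) (hx : x ∈ Icc (0 : ℝ) 1)
    (hy : y ∈ Icc (0 : ℝ) 1) (hxy : x < y) (hlt : β * g x < h x) : β * g y ≤ h y := by
  by_contra! hlt'
  -- Both inequalities are strict, so they already hold at a finite stage, where the crossing lemma
  -- applies.
  obtain ⟨n, hn1, hn2⟩ :=
    ((((tendsto_add_atTop_iff_nat 1).2 (tendsto_stepIter hx)).eventually_const_lt hlt).and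
    (((tendsto_add_atTop_iff_nat 1).2 (tendsto_stepIter hy)).eventually_lt_const hlt')).exists
  have key := avoidsNegPos_stepIter hg.toIsProfile n
  rw [Function.iterate_fixed hg.fixed] at key
  rw [stepIter_succ] at hn1 hn2
  refine key.false_of_opT (isProfile_stepIter n) hg.toIsProfile hβ hx.1 hxy ?_ ?_ <;>
  rw [hg.fixed] <;> linarith

/-- Near `1`, a fixed profile is at most `(1 - y)² / (2 r)`, for any `r < 1`. -/
lemma exists_le_sq (hf : IsFixedProfile f) {r : ℝ} (hr0 : 0 < r) (hr1 : r < 1) :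
    ∃ u < 1, ∀ y, u < y → y ≤ 1 → f y ≤ (1 - y) ^ 2 / (2 * r) := by
  have ha := hf.area_pos
  have hr : r ∈ Icc (0 : ℝ) 1 := ⟨hr0.le, hr1.le⟩
  have hτ : 0 < f r := lt_of_lt_of_le (by have := sub_pos.2 hr1; positivity) (hf.sq_le hr)
  -- The pseudo-inverse is at least `r` on `[0, f r]`, so `f` falls there with slope at least `r /
  -- area f`. Inverting gives a linear bound on the pseudo-inverse near `1`, whose integral is the
  -- quadratic bound.
  have hlow : ∀ s, 0 ≤ s → s ≤ f r → s * r / area f ≤ 1 - f s := by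
    intro s hs hsτ
    rw [← hf.zero, hf.sub_eq]
    have := intervalIntegral.integral_mono_on hs (intervalIntegrable_const (c := r))
      (intervalIntegrable_pseudoInv f 0 s) fun t ht => le_pseudoInv hr (ht.2.trans hsτ)
    rw [intervalIntegral.integral_const, sub_zero, smul_eq_mul] at this
    exact div_le_div_of_nonneg_right this ha.le
  refine ⟨f (f r), ?_, fun y hy hy1 => ?_⟩
  · have := hlow _ hτ.le le_rfl
    have : 0 < f r * r / area f := by positivity
    linarith
  have hbound : ∀ t ∈ Icc y 1, pseudoInv f t ≤ area f / r * (1 - t) := by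
    intro t ht
    refine le_of_forall_lt_imp_le_of_dense fun s hs => ?_
    have h1t : 0 ≤ 1 - t := sub_nonneg.2 ht.2
    rcases lt_or_ge s 0 with h0 | h0
    · exact h0.le.trans (by positivity)
    have hτt : pseudoInv f t ≤ f r := by
      by_contra! hlt
      exact (hy.trans_le ht.1).not_ge (hf.le_of_lt_pseudoInv hτ.le hlt)
    have h1 := hlow s h0 (hs.le.trans hτt)
    have h2 := hf.le_of_lt_pseudoInv h0 hs
    rw [div_mul_eq_mul_div, le_div_iff₀ hr0]
    rw [div_le_iff₀ ha] at h1
    nlinarith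
  have := intervalIntegral.integral_mono_on hy1 (intervalIntegrable_pseudoInv f y 1)
      (Continuous.intervalIntegrable (u := fun t => area f / r * (1 - t)) (by fun_prop) y 1) hbound
  rw [intervalIntegral.integral_const_mul, intervalIntegral.integral_sub (by simp) (by simp),
    integral_id, intervalIntegral.integral_const, smul_eq_mul] at this
  have h1 := hf.sub_eq y 1
  rw [hf.eq_zero_one, sub_zero] at h1
  rw [h1, div_le_iff₀ ha]
  refine this.trans_eq ?_
  field_simp
  ring

lemma eqOn_h (hg : IsFixedProfile g) : EqOn g h (Icc 0 1) := by
  intro x hx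
  refine le_antisymm (hg.le_h hx) ?_
  by_contra! hlt
  have hx1 : x < 1 := by
    refine lt_of_le_of_ne hx.2 ?_
    rintro rfl
    rw [hg.eq_zero_one, eqOn_h_opT hx, isFixedProfile_opT_h.eq_zero_one] at hlt
    exact hlt.false
  have hgx : 0 < g x := lt_of_lt_of_le (by have := sub_pos.2 hx1; positivity) (hg.sq_le hx)
  -- Choosing `1 < β < h x / g x` and `1/β < r < 1` makes the bounds `β (1 - y)² / 2 ≤ h y ≤ (1 -
  -- y)² / (2 r)` incompatible.
  obtain ⟨β, hβ1, hβ⟩ := exists_between ((one_lt_div hgx).2 hlt)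
  rw [lt_div_iff₀ hgx] at hβ
  have hβ0 : 0 < β := one_pos.trans hβ1
  obtain ⟨r, hr, hr1⟩ := exists_between (inv_lt_one_of_one_lt₀ hβ1)
  have hr0 : 0 < r := (inv_pos.2 hβ0).trans hr
  obtain ⟨u, hu, hle⟩ := isFixedProfile_opT_h.exists_le_sq hr0 hr1
  obtain ⟨y, hy, hy1⟩ := exists_between (max_lt hx1 hu)
  have hxy : x < y := (le_max_left _ _).trans_lt hy
  have hy' : y ∈ Icc (0 : ℝ) 1 := ⟨hx.1.trans hxy.le, hy1.le⟩
  have h1 := hg.mul_le_h hβ0 hx hy' hxy hβ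
  have h2 := hle y ((le_max_right _ _).trans_lt hy) hy1.le
  rw [← eqOn_h_opT hy'] at h2
  have h3 := mul_le_mul_of_nonneg_left (hg.sq_le hy') hβ0.le
  have h4 := (h3.trans h1).trans h2
  have h5 : 0 < (1 - y) ^ 2 := by have := sub_pos.2 hy1; positivity
  rw [le_div_iff₀ (by positivity)] at h4
  rw [inv_lt_iff_one_lt_mul₀ hβ0] at hr
  nlinarith

lemma strictAntiOn (hf : IsFixedProfile f) : StrictAntiOn f (Icc 0 1) := by
  intro x hx y hy hxy
  rw [← sub_pos, hf.sub_eq]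
  refine div_pos (intervalIntegral.intervalIntegral_pos_of_pos_on
    (intervalIntegrable_pseudoInv f x y) (fun t ht => ?_) hxy) hf.area_pos
  have := hf.le_pseudoInv_opT ⟨hx.1.trans ht.1.le, ht.2.le.trans hy.2⟩
  rw [hf.fixed] at this
  exact lt_of_lt_of_le (mul_pos hf.area_pos (sub_pos.2 (ht.2.trans_le hy.2))) this

end IsFixedProfile

/-! ### Fixed points and solutions of the equation -/

lemma pseudoInv_apply {f : ℝ → ℝ} (hf : StrictAntiOn f (Icc 0 1)) {x : ℝ}
    (hx : x ∈ Icc (0 : ℝ) 1) : pseudoInv f (f x) = x :=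
  le_antisymm (Real.sSup_le (fun _ hz => (hf.le_iff_ge hx hz.1).1 hz.2) hx.1)
    (le_pseudoInv hx le_rfl)

namespace IsFixedProfile

variable {f : ℝ → ℝ}

lemma continuous_pseudoInv (hf : IsFixedProfile f) : Continuous (pseudoInv f) := by
  refine continuous_iff_continuousAt.2 fun y => tendsto_order.2 ⟨fun a ha => ?_, fun b hb => ?_⟩
  · rcases lt_or_ge a 0 with h0 | h0
    · exact .of_forall fun z => h0.trans_le (pseudoInv_nonneg f z)
    obtain ⟨c, hac, hc⟩ := exists_between ha
    obtain ⟨d, hcd, hd⟩ := exists_between hc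
    have hd1 : d ≤ 1 := hd.le.trans (pseudoInv_le_one f y)
    have hc' : c ∈ Icc (0 : ℝ) 1 := ⟨h0.trans hac.le, hcd.le.trans hd1⟩
    have hd' : d ∈ Icc (0 : ℝ) 1 := ⟨hc'.1.trans hcd.le, hd1⟩
    have hlt : y < f c := (hf.le_of_lt_pseudoInv hd'.1 hd).trans_lt (hf.strictAntiOn hc' hd' hcd)
    filter_upwards [eventually_lt_nhds hlt] with z hz
    exact hac.trans_le (le_pseudoInv hc' hz.le)
  · rcases lt_or_ge 1 b with h1 | h1
    · exact .of_forall fun z => (pseudoInv_le_one f z).trans_lt h1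
    have hy : 0 < y := by
      by_contra! hle
      exact (hb.trans_le h1).not_ge
        (le_pseudoInv (right_mem_Icc.2 zero_le_one) (hle.trans_eq hf.eq_zero_one.symm))
    obtain ⟨c, hc, hcb⟩ := exists_between hb
    have hc0 : 0 ≤ c := (pseudoInv_nonneg f y).trans hc.le
    filter_upwards [eventually_gt_nhds (hf.lt_of_pseudoInv_lt hy hc0 hc)] with z hz
    refine lt_of_le_of_lt ?_ hcb
    by_contra! hlt
    exact hz.not_ge (hf.le_of_lt_pseudoInv hc0 hlt)

lemma hasDerivAt (hf : IsFixedProfile f) (x : ℝ) :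
    HasDerivAt f (-pseudoInv f x / area f) x := by
  have hc := hf.continuous_pseudoInv
  have := (intervalIntegral.integral_hasDerivAt_left (intervalIntegrable_pseudoInv f x 1)
    (hc.stronglyMeasurableAtFilter _ _) hc.continuousAt).div_const (area f)
  exact this.congr_of_eventuallyEq (.of_forall fun z => congrFun hf.fixed.symm z)

/-- Substitution turns the area under the inverse into `-∫ x f'(x)`, and integration by parts turns
that into `∫ f`. This identifies `κ`, defined through `h`, with the normalising constant of `opT`.
-/
lemma integral_eq_area (hf : IsFixedProfile f) : ∫ x in (0 : ℝ)..1, f x = area f := by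
  have hc := hf.continuous_pseudoInv
  have hf' : Continuous fun x => -pseudoInv f x / area f := by fun_prop
  have h1 := intervalIntegral.integral_comp_mul_deriv (a := 0) (b := 1) (fun x _ => hf.hasDerivAt x)
    hf'.continuousOn hc
  have h2 := intervalIntegral.integral_mul_deriv_eq_deriv_mul (a := 0) (b := 1)
    (fun x _ => hasDerivAt_id x) (fun x _ => hf.hasDerivAt x) (by simp)
    (hf'.intervalIntegrable 0 1)
  have h3 : ∫ x in (0 : ℝ)..1, (pseudoInv f ∘ f) x * (-pseudoInv f x / area f) =
      ∫ x in (0 : ℝ)..1, id x * (-pseudoInv f x / area f) := by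
    refine intervalIntegral.integral_congr fun x hx => ?_
    rw [uIcc_of_le zero_le_one] at hx
    simp only [Function.comp_apply, pseudoInv_apply hf.strictAntiOn hx, id]
  rw [h3, h2, hf.zero, hf.eq_zero_one, intervalIntegral.integral_symm 0 1] at h1
  simp only [id, one_mul, mul_zero, zero_mul, sub_zero, zero_sub, neg_inj] at h1
  exact h1

lemma bijOn (hf : IsFixedProfile f) : BijOn f (Icc 0 1) (Icc 0 1) := by
  refine ⟨fun x hx => ⟨hf.nonneg hx.1, hf.le_one hx.1⟩, hf.strictAntiOn.injOn, ?_⟩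
  have := intermediate_value_Icc' (zero_le_one' ℝ)
    (fun x _ => (hf.hasDerivAt x).continuousAt.continuousWithinAt)
  rwa [hf.zero, hf.eq_zero_one] at this

end IsFixedProfile

/-- Evaluating the equation at `g x` eliminates the inverse function. -/
lemma solvesIDE_iff {γ a : ℝ} {g : ℝ → ℝ} : SolvesIDE γ a g ↔
    BijOn g (Icc 0 a) (Icc 0 a) ∧ DifferentiableOn ℝ g (Icc 0 a) ∧
      ∀ x ∈ Icc 0 a, -γ * derivWithin g (Icc 0 a) (g x) = x := by
  refine and_congr_right fun hb => and_congr_right fun _ => ⟨fun hg x hx => ?_, fun hg y hy => ?_⟩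
  · rw [hg _ (hb.mapsTo hx), hb.injOn.leftInvOn_invFunOn hx]
  · obtain ⟨x, hx, rfl⟩ := hb.surjOn hy
    rw [hg x hx, hb.injOn.leftInvOn_invFunOn hx]

lemma SolvesIDE.congr {γ a : ℝ} {f g : ℝ → ℝ} (hf : SolvesIDE γ a f)
    (hfg : EqOn g f (Icc 0 a)) : SolvesIDE γ a g := by
  rw [solvesIDE_iff] at hf ⊢
  refine ⟨hf.1.congr hfg.symm, hf.2.1.congr hfg, fun x hx => ?_⟩
  rw [hfg hx, derivWithin_congr hfg (hfg (hf.1.mapsTo hx)), hf.2.2 x hx]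

lemma SolvesIDE.rescale {γ a c : ℝ} {g : ℝ → ℝ} (ha : 0 < a) (hc : 0 < c)
    (hg : SolvesIDE γ a g) : SolvesIDE (γ / c) (a / c) fun x => g (c * x) / c := by
  rw [solvesIDE_iff] at hg ⊢
  obtain ⟨hb, hd, he⟩ := hg
  have hmem : ∀ x, x ∈ Icc 0 (a / c) ↔ c * x ∈ Icc 0 a := fun x => by
    rw [mem_Icc, mem_Icc, le_div_iff₀' hc, mul_nonneg_iff_of_pos_left hc]
  have hmaps : MapsTo (fun x => c * x) (Icc 0 (a / c)) (Icc 0 a) := fun x hx => (hmem x).1 hx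
  have hder : ∀ x ∈ Icc 0 (a / c), HasDerivWithinAt (fun x => g (c * x) / c)
      (derivWithin g (Icc 0 a) (c * x)) (Icc 0 (a / c)) x := by
    intro x hx
    have h1 := ((hd _ (hmaps hx)).hasDerivWithinAt.comp x
      ((hasDerivAt_id x).const_mul c).hasDerivWithinAt hmaps).div_const c
    rw [mul_one, mul_div_cancel_right₀ _ hc.ne'] at h1
    exact h1
  have hbm : BijOn (fun x => g (c * x) / c) (Icc 0 (a / c)) (Icc 0 (a / c)) := by
    refine ⟨fun x hx => ?_, fun x hx y hy hxy => ?_, fun y hy => ?_⟩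
    · rw [hmem, mul_div_cancel₀ _ hc.ne']
      exact hb.mapsTo (hmaps hx)
    · have := hb.injOn (hmaps hx) (hmaps hy) ((div_left_inj' hc.ne').1 hxy)
      exact mul_left_cancel₀ hc.ne' this
    · obtain ⟨z, hz, hzy⟩ := hb.surjOn (hmaps hy)
      refine ⟨z / c, ?_, ?_⟩
      · rw [hmem, mul_div_cancel₀ _ hc.ne']
        exact hz
      · simp only [mul_div_cancel₀ z hc.ne', hzy]
        exact mul_div_cancel_left₀ y hc.ne'
  refine ⟨hbm, fun x hx => (hder x hx).differentiableWithinAt, fun x hx => ?_⟩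
  rw [(hder _ (hbm.mapsTo hx)).derivWithin
    (uniqueDiffOn_Icc (div_pos ha hc) _ (hbm.mapsTo hx)), mul_div_cancel₀ _ hc.ne']
  have := he _ (hmaps hx)
  rw [neg_mul, div_mul_eq_mul_div, ← neg_div, ← neg_mul, this]
  exact mul_div_cancel_left₀ x hc.ne'

lemma IsFixedProfile.solvesIDE {f : ℝ → ℝ} (hf : IsFixedProfile f) : SolvesIDE (area f) 1 f := by
  refine solvesIDE_iff.2 ⟨hf.bijOn, fun x _ =>
    (hf.hasDerivAt x).differentiableAt.differentiableWithinAt, fun x hx => ?_⟩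
  rw [(hf.hasDerivAt _).hasDerivWithinAt.derivWithin
    (uniqueDiffOn_Icc zero_lt_one _ (hf.bijOn.mapsTo hx)), pseudoInv_apply hf.strictAntiOn hx]
  have := hf.area_pos
  field_simp

lemma κ_eq_area : κ = area h := by
  rw [area, pseudoInv_congr eqOn_h_opT, ← area, ← isFixedProfile_opT_h.integral_eq_area]
  refine intervalIntegral.integral_congr fun x hx => ?_
  rw [uIcc_of_le zero_le_one] at hx
  exact eqOn_h_opT hx

lemma κ_pos : 0 < κ := κ_eq_area ▸ area_h_pos

lemma solvesIDE_h : SolvesIDE κ 1 h := by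
  have := isFixedProfile_opT_h.solvesIDE.congr eqOn_h_opT
  rwa [area, ← pseudoInv_congr eqOn_h_opT, ← area, ← κ_eq_area] at this

lemma SolvesIDE.eq_κ_and_eqOn {γ : ℝ} {g : ℝ → ℝ} (hγ : 0 < γ) (hg : SolvesIDE γ 1 g) :
    γ = κ ∧ EqOn g h (Icc 0 1) := by
  have m0 : (0 : ℝ) ∈ Icc (0 : ℝ) 1 := left_mem_Icc.2 zero_le_one
  have m1 : (1 : ℝ) ∈ Icc (0 : ℝ) 1 := right_mem_Icc.2 zero_le_one
  rw [solvesIDE_iff] at hg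
  obtain ⟨hb, hd, he⟩ := hg
  have hder : ∀ x ∈ Ioo (0 : ℝ) 1, HasDerivAt g (derivWithin g (Icc 0 1) x) x := fun x hx =>
    (hd x (Ioo_subset_Icc_self hx)).hasDerivWithinAt.hasDerivAt (Icc_mem_nhds hx.1 hx.2)
  -- The inverse takes values in `[0,1]`, so the equation forces `g' ≤ 0`.
  have hanti : AntitoneOn g (Icc 0 1) := by
    refine antitoneOn_of_deriv_nonpos (convex_Icc 0 1) hd.continuousOn
      (hd.mono interior_subset) fun x hx => ?_
    rw [interior_Icc] at hx
    obtain ⟨z, hz, rfl⟩ := hb.surjOn (Ioo_subset_Icc_self hx)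
    rw [(hder _ hx).deriv]
    have := he z hz
    have := hz.1
    by_contra! hpos
    nlinarith [mul_pos hγ hpos]
  have hstrict : StrictAntiOn g (Icc 0 1) := hanti.strictAntiOn_of_injOn hb.injOn
  have hinv : ∀ x ∈ Icc (0 : ℝ) 1, pseudoInv g x = -γ * derivWithin g (Icc 0 1) x := by
    intro x hx
    obtain ⟨z, hz, rfl⟩ := hb.surjOn hx
    rw [pseudoInv_apply hstrict hz, he z hz]
  have h0 : g 0 = 1 := by
    obtain ⟨z, hz, hz1⟩ := hb.surjOn m1
    exact le_antisymm (hb.mapsTo m0).2 (hz1 ▸ hanti m0 hz hz.1)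
  have h1 : g 1 = 0 := by
    obtain ⟨z, hz, hz0⟩ := hb.surjOn m0
    exact le_antisymm (hz0 ▸ hanti hz m1 hz.2) (hb.mapsTo m1).1
  have hint : ∀ x ∈ Icc (0 : ℝ) 1, ∫ t in x..1, pseudoInv g t = γ * g x := by
    intro x hx
    rw [intervalIntegral.integral_eq_sub_of_hasDerivAt_of_le (f := fun t => -γ * g t) hx.2
      ((hd.continuousOn.const_smul (-γ)).mono (Icc_subset_Icc_left hx.1)) (fun t ht => ?_)
      (intervalIntegrable_pseudoInv g x 1), h1]
    · ring
    · have ht' : t ∈ Ioo (0 : ℝ) 1 := ⟨hx.1.trans_lt ht.1, ht.2⟩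
      rw [hinv t (Ioo_subset_Icc_self ht')]
      exact (hder t ht').const_mul (-γ)
  have harea : area g = γ := by rw [area, hint 0 m0, h0, mul_one]
  have hfix : EqOn g (opT g) (Icc 0 1) := fun x hx => by
    rw [opT_apply, hint x hx, harea, mul_div_cancel_left₀ _ hγ.ne']
  have hp := isFixedProfile_opT hanti h0 h1.ge (harea.symm ▸ hγ) hfix
  have heq : EqOn g h (Icc 0 1) := hfix.trans hp.eqOn_h
  refine ⟨?_, heq⟩
  rw [← harea, κ_eq_area, area, area, pseudoInv_congr heq]

/-- Dini's theorem: continuous functions decrease to a continuous limit on a compact interval. -/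
lemma tendstoUniformlyOn_iter : TendstoUniformlyOn iter h atTop (Icc 0 1) := by
  refine Antitone.tendstoUniformlyOn_of_forall_tendsto isCompact_Icc (fun n => ?_)
    (fun x hx m n hmn => ?_) ?_ fun x hx => ?_
  · cases n with
    | zero => exact continuousOn_const
    | succ n =>
      rw [iter_succ, stepIter_succ]
      exact (isProfile_stepIter n).continuous_opT.continuousOn
  · simp only [eqOn_iter m hx, eqOn_iter n hx]
    exact antitone_stepIter hx hmn
  · refine ContinuousOn.congr (f := opT h) ?_ eqOn_h_opT
    exact fun x _ => (isFixedProfile_opT_h.hasDerivAt x).continuousAt.continuousWithinAt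
  · exact (tendsto_stepIter hx).congr fun n => (eqOn_iter n hx).symm

lemma isStandardStribola_hTilde : IsStandardStribola (1 / κ) hTilde := by
  refine ⟨one_div_pos.2 κ_pos, ?_⟩
  have := solvesIDE_h.rescale one_pos κ_pos
  rw [div_self κ_pos.ne'] at this
  exact this.congr fun x _ => by rw [hTilde, one_div_mul_eq_div]

lemma IsStandardStribola.unique {a : ℝ} {g : ℝ → ℝ} (hg : IsStandardStribola a g) :
    a = 1 / κ ∧ EqOn g hTilde (Icc 0 a) := by
  obtain ⟨ha, hs⟩ := hg
  -- Scaling by `a` itself yields a solution on `[0,1]` with `γ = 1/a`.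
  have := hs.rescale ha ha
  rw [div_self ha.ne'] at this
  obtain ⟨h1, h2⟩ := this.eq_κ_and_eqOn (one_div_pos.2 ha)
  refine ⟨by rw [← h1, one_div_one_div], fun x hx => ?_⟩
  have h3 := h2 (x := x / a) ⟨div_nonneg hx.1 ha.le, (div_le_one ha).2 hx.2⟩
  simp only [mul_div_cancel₀ x ha.ne'] at h3
  rw [hTilde, ← h1, one_div_one_div, one_div_mul_eq_div, ← h3, mul_div_cancel₀ _ ha.ne']

end Stribola

theorem mainTheorem3 :
    -- the function `h` is well defined: it is the uniform limit of the iterates, with area `κ > 0`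
    TendstoUniformlyOn Stribola.iter Stribola.h atTop (Icc 0 1) ∧
    0 < Stribola.κ ∧
    -- the equation has a solution on `[0,1]` for `γ = κ` and for no other `γ > 0`
    (∀ γ : ℝ, 0 < γ → ((∃ g : ℝ → ℝ, Stribola.SolvesIDE γ 1 g) ↔ γ = Stribola.κ)) ∧
    -- `h` is the only unit stribola
    Stribola.IsUnitStribola Stribola.h ∧
    (∀ g : ℝ → ℝ, Stribola.IsUnitStribola g → EqOn g Stribola.h (Icc 0 1)) ∧
    -- the rescaled function on `[0,1/κ]` is the only standard stribola
    Stribola.IsStandardStribola (1 / Stribola.κ) Stribola.hTilde ∧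
    (∀ (a : ℝ) (g : ℝ → ℝ), Stribola.IsStandardStribola a g →
      a = 1 / Stribola.κ ∧ EqOn g Stribola.hTilde (Icc 0 a)) :=
  ⟨Stribola.tendstoUniformlyOn_iter, Stribola.κ_pos,
    fun _ hγ => ⟨fun ⟨_, hg⟩ => (hg.eq_κ_and_eqOn hγ).1,
      fun hγκ => ⟨_, hγκ ▸ Stribola.solvesIDE_h⟩⟩,
    ⟨_, Stribola.κ_pos, Stribola.solvesIDE_h⟩,
    fun _ ⟨_, hγ, hg⟩ => (hg.eq_κ_and_eqOn hγ).2,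
    Stribola.isStandardStribola_hTilde, fun _ _ hg => hg.unique⟩
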